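/- Let $\Lambda$ be a set of spectral parameters and let $b_\pm, c_\pm, a_-:\Lambda\times\Lambda\to\mathbb C$ be the Boltzmann weights of an asymmetric six-vertex model, with $R$-matrix on $\mathbb C^2\otimes\mathbb C^2$ $$R(\lambda_1,\lambda_2)=\begin{pmatrix}1&0&0&0\\0&b_+&c_+&0\\0&c_-&b_-&0\\0&0&0&a_-\end{pmatrix}(\lambda_1,\lambda_2).$$ Assume that for all parameters in $\Lambda$ the $R$-matrix satisfies unitarity, $R_{12}(\lambda_1,\lambda_2)R_{21}(\lambda_2,\lambda_1)=\mathrm{Id}$, and the Yang–Baxter equation, $$R_{12}(\lambda_1,\lambda_2)R_{13}(\lambda_1,\lambda_3)R_{23}(\lambda_2,\lambda_3)=R_{23}(\lambda_2,\lambda_3)R_{13}(\lambda_1,\lambda_3)R_{12}(\lambda_1,\lambda_2).$$ Let $\xi_1,\dots,\xi_L\in\Lambda$ (inhomogeneities), $1\le l_1<\dots<l_M\le L$ and $\mu_1,\dots,\mu_M\in\Lambda$ (rapidities), and assume $b_-(\xi_{l_i},\xi_{l_j})\neq0$ for all $i\ne j$. Let $B_{l_1\dots l_M}(\mu)$ be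 the upper right entry, as a $2\times2$ matrix in the auxiliary space $a$, of the monodromy matrix $$\mathcal T_a(\mu)=R_{a l_M}(\mu,\xi_{l_M})\cdots R_{a l_2}(\mu,\xi_{l_2})\,R_{a l_1}(\mu,\xi_{l_1}),$$ and define the type-$B$ domain wall partition function by $$Z^{(B)}_M(\{\mu\},\{\xi_l\})=\langle 1|\,B_{l_1\dots l_M}(\mu_1)\cdots B_{l_1\dots l_M}(\mu_M)\,|0\rangle,\qquad \langle 1|=\bigotimes_{i=1}^M(0,1),\quad |0\rangle=\bigotimes_{i=1}^M\binom10 .$$ Put $\theta(\xi_i,\xi_j)=a_-(\xi_i,\xi_j)$ if $i<j$ and $\theta(\xi_i,\xi_j)=1$ if $i\ge j$. Then $$Z^{(B)}_M(\{\mu\},\{\xi_l\})=\sum_{\sigma\in S_M}\ \prod_{i=1}^M c_+(\mu_i,\xi_{l_{\sigma_i}})\prod_{1\le j<k\le M}\frac{b_-(\mu_k,\xi_{l_{\sigma_j}})\,a_-(\mu_j,\xi_{l_{\sigma_k}})}{b_-(\xi_{l_{\sigma_k}},\xi_{l_{\sigma_j}})\,\theta(\xi_{l_{\sigma_j}},\xi_{l_{\sigma_k}})}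 .$$ -/

import Mathlib

namespace SixVertex

/-- The Boltzmann weights of the asymmetric six-vertex model, as functions of two spectral
parameters taken from a set `Λ` (the weight `a₊` is normalised to `1`). -/
structure Weights (Λ : Type*) where
  bPlus : Λ → Λ → ℂ
  bMinus : Λ → Λ → ℂ
  cPlus : Λ → Λ → ℂ
  cMinus : Λ → Λ → ℂ
  aMinus : Λ → Λ → ℂ

variable {Λ : Type*}

/-- The `4 × 4` matrix `R(x, y)`. The basis vectors `(1,0)ᵀ` and `(0,1)ᵀ` of `ℂ²` are indexed by
`0` and `1`; rows and columns are in the order `(0,0), (0,1), (1,0), (1,1)`. -/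
def Weights.R (w : Weights Λ) (x y : Λ) : Matrix (Fin 2 × Fin 2) (Fin 2 × Fin 2) ℂ :=
  fun s t => match s, t with
  | (0, 0), (0, 0) => 1
  | (0, 1), (0, 1) => w.bPlus x y
  | (0, 1), (1, 0) => w.cPlus x y
  | (1, 0), (0, 1) => w.cMinus x y
  | (1, 0), (1, 0) => w.bMinus x y
  | (1, 1), (1, 1) => w.aMinus x y
  | _, _ => 0

/-- `R_{ij}(x, y)`: the matrix `R(x, y)` acting on the `i`-th and `j`-th factors (in this order) of
the tensor product of copies of `ℂ²` labelled by `ι`, and as the identity on all other factors.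
The basis of the tensor product is indexed by `ι → Fin 2`. -/
def Weights.act {ι : Type*} [Fintype ι] [DecidableEq ι] (w : Weights Λ) (i j : ι) (x y : Λ) :
    Matrix (ι → Fin 2) (ι → Fin 2) ℂ :=
  fun s t => if ∀ k, k ≠ i → k ≠ j → s k = t k then w.R x y (s i, s j) (t i, t j) else 0

/-- Unitarity: `R₁₂(x, y) R₂₁(y, x) = 1` on `ℂ² ⊗ ℂ²`. -/
def Weights.Unitarity (w : Weights Λ) : Prop :=
  ∀ x y : Λ, w.act (0 : Fin 2) 1 x y * w.act (1 : Fin 2) 0 y x = 1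

/-- The Yang-Baxter equation
`R₁₂(x, y) R₁₃(x, z) R₂₃(y, z) = R₂₃(y, z) R₁₃(x, z) R₁₂(x, y)` on `ℂ² ⊗ ℂ² ⊗ ℂ²`. -/
def Weights.YangBaxter (w : Weights Λ) : Prop :=
  ∀ x y z : Λ,
    w.act (0 : Fin 3) 1 x y * w.act (0 : Fin 3) 2 x z * w.act (1 : Fin 3) 2 y z =
      w.act (1 : Fin 3) 2 y z * w.act (0 : Fin 3) 2 x z * w.act (0 : Fin 3) 1 x y

/-- The monodromy matrix `T_a(x) = R_{aM}(x, ξ_M) ⋯ R_{a2}(x, ξ₂) R_{a1}(x, ξ₁)` of `M` sites with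
inhomogeneities `ξ`. The auxiliary space `a` is labelled by `none`, the sites by `some i`. -/
def Weights.monodromy (w : Weights Λ) {M : ℕ} (ξ : Fin M → Λ) (x : Λ) :
    Matrix (Option (Fin M) → Fin 2) (Option (Fin M) → Fin 2) ℂ :=
  ((List.ofFn fun i : Fin M => w.act none (some i) x (ξ i)).reverse).prod

/-- The operator `B(x)` on the `M` sites: the upper right block, in the auxiliary space, of the
monodromy matrix. -/
def Weights.B (w : Weights Λ) {M : ℕ} (ξ : Fin M → Λ) (x : Λ) :
    Matrix (Fin M → Fin 2) (Fin M → Fin 2) ℂ :=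
  fun s t => w.monodromy ξ x (fun o => o.elim 0 s) (fun o => o.elim 1 t)

/-- The type-B domain wall partition function `⟨1| B(μ₁) B(μ₂) ⋯ B(μ_M) |0⟩` of `M` sites, where
`⟨1| = ⊗ (0,1)` and `|0⟩ = ⊗ (1,0)ᵀ`. -/
def Weights.ZB (w : Weights Λ) {M : ℕ} (μ ξ : Fin M → Λ) : ℂ :=
  (List.ofFn fun i : Fin M => w.B ξ (μ i)).prod (fun _ => 1) (fun _ => 0)

/-- `θ(ξ_i, ξ_j)`, which is `a₋(ξ_i, ξ_j)` if `i < j` and `1` if `i ≥ j`. -/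
def Weights.theta (w : Weights Λ) {L : ℕ} (ξ : Fin L → Λ) (i j : Fin L) : ℂ :=
  if i < j then w.aMinus (ξ i) (ξ j) else 1

end SixVertex

open scoped Matrix

/-! The proof expands the partition function along its last rapidity. A vacuum column of `B(x)` is
the monodromy matrix applied to one excitation in the auxiliary factor. By
`monodromyOn_mulVec_excited` it is a sum over sites `i` of a scalar times `toFront i` applied to the
excitation at `i`. The scalar is `c₊(x, ξ_i) ∏_{k ≠ i} b₋(x, ξ_k) / b₋(ξ_i, ξ_k)`, and the only
identity between weights it needs is `cPlus_eq_add`.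

The other operators `B` pass through `toFront i` by Yang-Baxter (`B_mul_toFront`) and become
`BFront`. With site `i` in state `1`, `BFront` is `a₋(x, ξ_i)` times the `B` of the chain without
`i` (`BFront_apply`). Finally `⟨1|` is a left eigenvector of `toFront i`, with eigenvalue `∏_{j<i}
a₋(ξ_i, ξ_j)`, which unitarity turns into a product of `1/θ`.

The result is the recursion `ZB_succ`. Iterating it chooses `σ_M`, then `σ_{M-1}`, and so on, which
gives the sum over permutations. -/

namespace SixVertex

section

variable {Λ : Type*} {ι ι' : Type*} [Fintype ι] [DecidableEq ι] [Fintype ι'] [DecidableEq ι']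

/-! ### Operators acting on some of the tensor factors. -/

/-- The operator on the tensor product over `ι` that acts as `A` on the factors in the range of
`e` and as the identity on the others. -/
def embed (e : ι' → ι) (A : Matrix (ι' → Fin 2) (ι' → Fin 2) ℂ) :
    Matrix (ι → Fin 2) (ι → Fin 2) ℂ :=
  fun s t => if ∀ k, (∀ i, e i ≠ k) → s k = t k then A (s ∘ e) (t ∘ e) else 0

theorem embed_mul {e : ι' → ι} (he : Function.Injective e)
    (A B : Matrix (ι' → Fin 2) (ι' → Fin 2) ℂ) : embed e (A * B) = embed e A * embed e B := by
  ext s t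
  rw [Matrix.mul_apply]
  have hex : ∀ v : ι' → Fin 2, Function.extend e v s ∘ e = v := fun v =>
    funext fun i => he.extend_apply v s i
  have hoff : ∀ (v : ι' → Fin 2) (k : ι), (∀ i, e i ≠ k) → Function.extend e v s k = s k :=
    fun v k hk => Function.extend_apply' _ _ _ (by rintro ⟨i, hi⟩; exact hk i hi)
  -- Only intermediate states that agree with `s` off the range of `e` contribute; they are the
  -- extensions of `v` by `s`.
  rw [← Fintype.sum_of_injective (fun v : ι' → Fin 2 => Function.extend e v s)
    (fun v v' h => by rw [← hex v, ← hex v']; exact congrArg (· ∘ e) h)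
    (fun v => if ∀ k, (∀ i, e i ≠ k) → s k = t k then A (s ∘ e) v * B v (t ∘ e) else 0)]
  · simp only [embed, Matrix.mul_apply]
    split_ifs <;> simp
  · intro u hu
    rw [embed, if_neg, zero_mul]
    intro h
    refine hu ⟨u ∘ e, ?_⟩
    funext k
    by_cases hk : ∃ i, e i = k
    · obtain ⟨i, rfl⟩ := hk
      exact he.extend_apply _ _ _
    · exact (hoff _ _ (by simpa using hk)).trans (h k (by simpa using hk))
  · intro v
    have h1 : ∀ k, (∀ i, e i ≠ k) → s k = Function.extend e v s k :=
      fun k hk => (hoff v k hk).symm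
    have h2 : (∀ k, (∀ i, e i ≠ k) → Function.extend e v s k = t k) ↔
        ∀ k, (∀ i, e i ≠ k) → s k = t k :=
      forall_congr' fun k => forall_congr' fun hk => by rw [hoff v k hk]
    simp only [embed, if_pos h1, hex, h2]
    split_ifs <;> simp

omit [DecidableEq ι'] in
theorem embed_one (e : ι' → ι) : embed e (1 : Matrix (ι' → Fin 2) (ι' → Fin 2) ℂ) = 1 := by
  ext s t
  simp only [embed, Matrix.one_apply, ← ite_and]
  congr 1
  refine propext ⟨fun ⟨h, h'⟩ => funext fun k => ?_, ?_⟩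
  · by_cases hk : ∃ i, e i = k
    · obtain ⟨i, rfl⟩ := hk
      exact congrFun h' i
    · exact h k (by simpa using hk)
  · rintro rfl
    simp

theorem embed_list_prod {e : ι' → ι} (he : Function.Injective e)
    (l : List (Matrix (ι' → Fin 2) (ι' → Fin 2) ℂ)) :
    embed e l.prod = (l.map (embed e)).prod := by
  induction l with
  | nil => exact embed_one e
  | cons A l ih => rw [List.prod_cons, List.map_cons, List.prod_cons, embed_mul he, ih]

theorem embed_act (w : Weights Λ) {e : ι' → ι} (he : Function.Injective e) (i j : ι') (x y : Λ) :
    embed e (w.act i j x y) = w.act (e i) (e j) x y := by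
  ext s t
  simp only [embed, Weights.act, ← ite_and, Function.comp_apply]
  congr 1
  refine propext ⟨fun ⟨h, h'⟩ k hi hj => ?_, fun h => ⟨fun k hk => h k (hk i).symm (hk j).symm,
    fun k hi hj => h _ (he.ne hi) (he.ne hj)⟩⟩
  by_cases hk : ∃ m, e m = k
  · obtain ⟨m, rfl⟩ := hk
    exact h' m (fun h => hi (congrArg e h)) fun h => hj (congrArg e h)
  · exact h k (by simpa using hk)

theorem act_mul_act_apply (w : Weights Λ) {i j k l : ι} (hik : i ≠ k) (hil : i ≠ l) (hjk : j ≠ k)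
    (hjl : j ≠ l) (x y x' y' : Λ) (s t : ι → Fin 2) :
    (w.act i j x y * w.act k l x' y') s t =
      if ∀ m, m ≠ i → m ≠ j → m ≠ k → m ≠ l → s m = t m then
        w.R x y (s i, s j) (t i, t j) * w.R x' y' (s k, s l) (t k, t l) else 0 := by
  -- The unique possible intermediate state: the right factor leaves `i, j` as in `t`, the left
  -- factor leaves everything else as in `s`.
  rw [Matrix.mul_apply, Finset.sum_eq_single (fun m => if m = i ∨ m = j then t m else s m)]
  · have h1 : ∀ m, m ≠ i → m ≠ j → s m = if m = i ∨ m = j then t m else s m := by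
      intro m hi hj
      simp [hi, hj]
    have h2 : (∀ m, m ≠ k → m ≠ l → (if m = i ∨ m = j then t m else s m) = t m) ↔
        ∀ m, m ≠ i → m ≠ j → m ≠ k → m ≠ l → s m = t m := by
      refine ⟨fun h m hi hj hk hl => by simpa [hi, hj] using h m hk hl, fun h m hk hl => ?_⟩
      split_ifs with hm
      · rfl
      · exact h m (fun h => hm (Or.inl h)) (fun h => hm (Or.inr h)) hk hl
    simp only [Weights.act, if_pos h1, h2]
    split_ifs <;> simp_all [eq_comm]
  · intro u _ hu
    by_contra hne
    have h1 : ∀ m, m ≠ i → m ≠ j → s m = u m := by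
      by_contra h
      exact hne (by rw [Weights.act, if_neg h, zero_mul])
    have h2 : ∀ m, m ≠ k → m ≠ l → u m = t m := by
      by_contra h
      exact hne (by rw [Weights.act, Weights.act, if_neg h, mul_zero])
    refine hu (funext fun m => ?_)
    split_ifs with hm
    · rcases hm with rfl | rfl
      · exact h2 _ hik hil
      · exact h2 _ hjk hjl
    · exact (h1 m (fun h => hm (Or.inl h)) fun h => hm (Or.inr h)).symm
  · simp

theorem act_commute (w : Weights Λ) {i j k l : ι} (hik : i ≠ k) (hil : i ≠ l) (hjk : j ≠ k)
    (hjl : j ≠ l) (x y x' y' : Λ) : Commute (w.act i j x y) (w.act k l x' y') := by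
  ext s t
  rw [act_mul_act_apply w hik hil hjk hjl,
    act_mul_act_apply w hik.symm hjk.symm hil.symm hjl.symm, mul_comm (w.R x y _ _)]
  congr 1
  exact propext ⟨fun h m a b c d => h m c d a b, fun h m a b c d => h m c d a b⟩

/-- `embed` along an injection is multiplicative, so the relation on three factors transfers to any
three distinct factors. -/
theorem Weights.YangBaxter.act {w : Weights Λ} (h : w.YangBaxter) {i j k : ι} (hij : i ≠ j)
    (hik : i ≠ k) (hjk : j ≠ k) (x y z : Λ) :
    w.act i j x y * w.act i k x z * w.act j k y z =
      w.act j k y z * w.act i k x z * w.act i j x y := by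
  have he : Function.Injective ![i, j, k] := by
    intro a b
    fin_cases a <;> fin_cases b <;> simp [hij, hik, hjk, hij.symm, hik.symm, hjk.symm]
  have := congrArg (embed ![i, j, k]) (h x y z)
  simpa [embed_mul he, embed_act w he] using this

/-! ### The action of `R` on one excitation and on doubly excited pairs. -/

/-- The basis vector with a single factor `a` in the state `1` and all others in the state `0`. -/
def excited (a : ι) : (ι → Fin 2) → ℂ := Pi.single (Pi.single a 1) 1

theorem excited_apply (a : ι) (s : ι → Fin 2) :
    excited a s = if s = Pi.single a 1 then 1 else 0 := by
  rw [excited, Pi.single_apply]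

theorem act_mulVec_excited_apply (w : Weights Λ) (i j k : ι) (x y : Λ) (s : ι → Fin 2) :
    (w.act i j x y *ᵥ excited k) s = w.act i j x y s (Pi.single k 1) := by
  simp [excited]

omit [Fintype ι] in
theorem eq_single_iff {i j : ι} (hij : i ≠ j) (s : ι → Fin 2) :
    s = Pi.single i 1 ↔ (∀ k, k ≠ i → k ≠ j → s k = 0) ∧ s i = 1 ∧ s j = 0 := by
  refine ⟨?_, fun ⟨h, hi, hj⟩ => funext fun k => ?_⟩
  · rintro rfl
    exact ⟨fun k hk _ => by simp [hk], by simp, by simp [hij.symm]⟩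
  · by_cases hki : k = i
    · subst hki; simpa using hi
    · by_cases hkj : k = j
      · subst hkj; simpa [hki] using hj
      · simpa [hki] using h k hki hkj

theorem act_mulVec_excited_fst (w : Weights Λ) {i j : ι} (hij : i ≠ j) (x y : Λ) :
    w.act i j x y *ᵥ excited i = w.bMinus x y • excited i + w.cPlus x y • excited j := by
  ext s
  have h0 : (∀ k, k ≠ i → k ≠ j → s k = (Pi.single i 1 : ι → Fin 2) k) ↔
      ∀ k, k ≠ i → k ≠ j → s k = 0 :=
    forall_congr' fun k => forall_congr' fun hk => by simp [hk]
  have h1 := eq_single_iff hij s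
  have h2 := eq_single_iff hij.symm s
  rw [act_mulVec_excited_apply]
  simp only [Weights.act, h0, Pi.add_apply, Pi.smul_apply, excited_apply, h1, h2,
    Pi.single_eq_same, Pi.single_eq_of_ne hij.symm]
  by_cases h : ∀ k, k ≠ i → k ≠ j → s k = 0
  · have h' : ∀ k, k ≠ j → k ≠ i → s k = 0 := fun k a b => h k b a
    rw [if_pos h]
    simp only [eq_true h, eq_true h', true_and]
    generalize s i = a, s j = b
    fin_cases a <;> fin_cases b <;> simp [Weights.R]
  · have h' : ¬ ∀ k, k ≠ j → k ≠ i → s k = 0 := fun g => h fun k a b => g k b a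
    simp [h, h']

theorem act_mulVec_excited_snd (w : Weights Λ) {i j : ι} (hij : i ≠ j) (x y : Λ) :
    w.act i j x y *ᵥ excited j = w.bPlus x y • excited j + w.cMinus x y • excited i := by
  ext s
  have h0 : (∀ k, k ≠ i → k ≠ j → s k = (Pi.single j 1 : ι → Fin 2) k) ↔
      ∀ k, k ≠ i → k ≠ j → s k = 0 :=
    forall_congr' fun k => forall_congr' fun _ => forall_congr' fun hk => by simp [hk]
  have h1 := eq_single_iff hij s
  have h2 := eq_single_iff hij.symm s
  rw [act_mulVec_excited_apply]
  simp only [Weights.act, h0, Pi.add_apply, Pi.smul_apply, excited_apply, h1, h2,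
    Pi.single_eq_same, Pi.single_eq_of_ne hij]
  by_cases h : ∀ k, k ≠ i → k ≠ j → s k = 0
  · have h' : ∀ k, k ≠ j → k ≠ i → s k = 0 := fun k a b => h k b a
    rw [if_pos h]
    simp only [eq_true h, eq_true h', true_and]
    generalize s i = a, s j = b
    fin_cases a <;> fin_cases b <;> simp [Weights.R]
  · have h' : ¬ ∀ k, k ≠ j → k ≠ i → s k = 0 := fun g => h fun k a b => g k b a
    simp [h, h']

theorem act_mulVec_excited_of_ne (w : Weights Λ) {i j k : ι} (hik : i ≠ k) (hjk : j ≠ k)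
    (x y : Λ) : w.act i j x y *ᵥ excited k = excited k := by
  ext s
  rw [act_mulVec_excited_apply, excited_apply, Weights.act]
  by_cases h : s = Pi.single k 1
  · subst h
    simp [hik, hjk, Weights.R]
  · rw [if_neg h, ite_eq_right_iff]
    intro h'
    have : ¬ (s i = 0 ∧ s j = 0) := by
      rintro ⟨hi, hj⟩
      refine h (funext fun m => ?_)
      by_cases hmi : m = i
      · subst hmi; simp [hi, hik]
      · by_cases hmj : m = j
        · subst hmj; simp [hj, hjk]
        · exact h' m hmi hmj
    simp only [Pi.single_apply, hik, hjk, if_false]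
    revert this
    generalize s i = a, s j = b
    fin_cases a <;> fin_cases b <;> simp [Weights.R]

/-- `R` conserves the number of excitations, and `(1, 1)` is alone in its sector. The row case
serves `⟨1|`, the column case `BFront_apply`. -/
theorem act_apply_of_eq_one (w : Weights Λ) {i j : ι} {s t : ι → Fin 2} (x y : Λ)
    (h : s i = 1 ∧ s j = 1 ∨ t i = 1 ∧ t j = 1) :
    w.act i j x y s t = if s = t then w.aMinus x y else 0 := by
  rw [Weights.act]
  by_cases hst : s = t
  · subst hst
    rcases h with h | h <;> simp [h.1, h.2, Weights.R]
  · rw [if_neg hst, ite_eq_right_iff]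
    intro h'
    have : ¬ (s i = t i ∧ s j = t j) := by
      rintro ⟨hi, hj⟩
      refine hst (funext fun m => ?_)
      by_cases hmi : m = i
      · rw [hmi, hi]
      · by_cases hmj : m = j
        · rw [hmj, hj]
        · exact h' m hmi hmj
    revert this h
    generalize s i = a, s j = b, t i = c, t j = d
    fin_cases a <;> fin_cases b <;> fin_cases c <;> fin_cases d <;> simp [Weights.R]

theorem excited_apply_single (a b : ι) :
    excited a (Pi.single b 1) = if b = a then 1 else 0 := by
  rw [excited_apply]
  congr 1
  refine propext ⟨fun h => ?_, fun h => by rw [h]⟩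
  by_contra hne
  have := congrFun h b
  simp [hne] at this

/-! ### Scalar identities between the weights. -/

/-- The Yang-Baxter matrix element that carries an excitation from the first factor to the second.
-/
theorem Weights.YangBaxter.cPlus_mul_bMinus {w : Weights Λ} (h : w.YangBaxter) (x y z : Λ) :
    w.cPlus x y * w.bMinus x z =
      w.cPlus x y * w.bMinus y z + w.cPlus x z * w.bMinus x y * w.cMinus y z := by
  have h1 := congrArg (fun A => (A *ᵥ excited 0) (Pi.single 1 1)) (h x y z)
  simp only [← Matrix.mulVec_mulVec, act_mulVec_excited_fst w (show (0 : Fin 3) ≠ 1 by decide),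
    act_mulVec_excited_fst w (show (0 : Fin 3) ≠ 2 by decide),
    act_mulVec_excited_fst w (show (1 : Fin 3) ≠ 2 by decide),
    act_mulVec_excited_snd w (show (1 : Fin 3) ≠ 2 by decide),
    act_mulVec_excited_of_ne w (show (0 : Fin 3) ≠ 1 by decide) (show (2 : Fin 3) ≠ 1 by decide),
    act_mulVec_excited_of_ne w (show (0 : Fin 3) ≠ 2 by decide) (show (1 : Fin 3) ≠ 2 by decide),
    act_mulVec_excited_of_ne w (show (1 : Fin 3) ≠ 0 by decide) (show (2 : Fin 3) ≠ 0 by decide),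
    Matrix.mulVec_add, Matrix.mulVec_smul, Pi.add_apply, Pi.smul_apply, excited_apply_single] at h1
  simp at h1
  linear_combination h1

theorem Weights.Unitarity.cMinus_mul_bMinus {w : Weights Λ} (h : w.Unitarity) (x y : Λ) :
    w.cMinus x y * w.bMinus y x + w.bMinus x y * w.cPlus y x = 0 := by
  have h1 := congrArg (fun A => (A *ᵥ excited 1) (Pi.single 0 1)) (h x y)
  simp only [← Matrix.mulVec_mulVec, act_mulVec_excited_fst w (show (0 : Fin 2) ≠ 1 by decide),
    act_mulVec_excited_snd w (show (0 : Fin 2) ≠ 1 by decide),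
    act_mulVec_excited_fst w (show (1 : Fin 2) ≠ 0 by decide),
    Matrix.mulVec_add, Matrix.mulVec_smul, Pi.add_apply, Pi.smul_apply, excited_apply_single,
    Matrix.one_mulVec] at h1
  simp at h1
  linear_combination h1

theorem Weights.Unitarity.aMinus_mul_aMinus {w : Weights Λ} (h : w.Unitarity) (x y : Λ) :
    w.aMinus x y * w.aMinus y x = 1 := by
  have h1 := congrFun (congrFun (h x y) (fun _ => 1)) (fun _ => 1)
  simpa [Matrix.mul_apply, act_apply_of_eq_one] using h1

/-- Divide the Yang-Baxter identity by `b₋(y, z)` and replace `c₋(y, z) / b₋(y, z)` by `-c₊(z, y) /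
b₋(z, y)`, which is unitarity. -/
theorem cPlus_eq_add {w : Weights Λ} (hU : w.Unitarity) (hYB : w.YangBaxter) {x y z : Λ}
    (hyz : w.bMinus y z ≠ 0) (hzy : w.bMinus z y ≠ 0) :
    w.cPlus x y = w.cPlus x y * (w.bMinus x z / w.bMinus y z) +
      w.cPlus x z * w.cPlus z y * (w.bMinus x y / w.bMinus z y) := by
  field_simp
  linear_combination (-w.bMinus z y) * hYB.cPlus_mul_bMinus x y z -
    w.cPlus x z * w.bMinus x y * hU.cMinus_mul_bMinus y z

/-! ### Monodromy matrices over lists and the expansion of an excitation. -/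

/-- The monodromy matrix with auxiliary factor `a`, over the factors in a list `l`, with
inhomogeneities `p`. -/
def Weights.monodromyOn (w : Weights Λ) (p : ι → Λ) (a : ι) (x : Λ) (l : List ι) :
    Matrix (ι → Fin 2) (ι → Fin 2) ℂ :=
  (l.map fun j => w.act a j x (p j)).prod

/-- The part of a list behind the first occurrence of `i`. -/
def suffixAfter (i : ι) : List ι → List ι
  | [] => []
  | n :: l => if n = i then l else suffixAfter i l

omit [Fintype ι] in
theorem exists_eq_append_suffixAfter {i : ι} {l : List ι} (h : i ∈ l) :
    ∃ m, l = m ++ i :: suffixAfter i l := by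
  induction l with
  | nil => simp at h
  | cons n l ih =>
    by_cases hn : n = i
    · subst hn
      exact ⟨[], by simp [suffixAfter]⟩
    · obtain ⟨m, hm⟩ := ih ((List.mem_cons.1 h).resolve_left (Ne.symm hn))
      refine ⟨n :: m, ?_⟩
      rw [suffixAfter, if_neg hn, List.cons_append, ← hm]

theorem monodromyOn_cons (w : Weights Λ) (p : ι → Λ) (a : ι) (x : Λ) (n : ι) (l : List ι) :
    w.monodromyOn p a x (n :: l) = w.act a n x (p n) * w.monodromyOn p a x l := by
  simp [Weights.monodromyOn]

theorem monodromyOn_append (w : Weights Λ) (p : ι → Λ) (a : ι) (x : Λ) (m l : List ι) :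
    w.monodromyOn p a x (m ++ l) = w.monodromyOn p a x m * w.monodromyOn p a x l := by
  simp [Weights.monodromyOn]

theorem commute_act_monodromyOn (w : Weights Λ) (p : ι → Λ) {i j a : ι} (x y z : Λ)
    {l : List ι} (hi : i ∉ l) (hj : j ∉ l) (hia : i ≠ a) (hja : j ≠ a) :
    Commute (w.act i j x y) (w.monodromyOn p a z l) := by
  refine Commute.list_prod_right _ _ fun A hA => ?_
  obtain ⟨k, hk, rfl⟩ := List.mem_map.1 hA
  exact act_commute w hia (fun h => hi (h ▸ hk)) hja (fun h => hj (h ▸ hk)) _ _ _ _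

theorem commute_monodromyOn (w : Weights Λ) (p : ι → Λ) {i a : ι} (x y : Λ)
    {m l : List ι} (hml : m.Disjoint l) (ha : a ∉ l) (hi : i ∉ m) (hia : i ≠ a) :
    Commute (w.monodromyOn p a x m) (w.monodromyOn p i y l) := by
  refine Commute.list_prod_left _ _ fun A hA => ?_
  obtain ⟨k, hk, rfl⟩ := List.mem_map.1 hA
  exact commute_act_monodromyOn w p _ _ _ ha (fun h => hml hk h) hia.symm fun h => hi (h ▸ hk)

/-- The RTT relation: `R_{ai}` is moved through one pair `R_{aj} R_{ij}` at a time. -/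
theorem act_mul_monodromyOn_mul_monodromyOn {w : Weights Λ} (hYB : w.YangBaxter) (p : ι → Λ)
    {a i : ι} (hai : a ≠ i) (x : Λ) {l : List ι} (hl : l.Nodup) (ha : a ∉ l) (hi : i ∉ l) :
    w.act a i x (p i) * w.monodromyOn p a x l * w.monodromyOn p i (p i) l =
      w.monodromyOn p i (p i) l * (w.monodromyOn p a x l * w.act a i x (p i)) := by
  induction l with
  | nil => simp [Weights.monodromyOn]
  | cons j l ih =>
    rw [List.nodup_cons] at hl
    simp only [List.mem_cons, not_or] at ha hi
    have h1 := (commute_act_monodromyOn w p (p i) (p j) x hi.2 hl.1 hai.symm (Ne.symm ha.1)).eq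
    have h2 := (commute_act_monodromyOn w p x (p j) (p i) ha.2 hl.1 hai (Ne.symm hi.1)).eq
    have h3 := hYB.act hai ha.1 hi.1 x (p i) (p j)
    have h4 := ih hl.2 ha.2 hi.2
    simp only [monodromyOn_cons]
    generalize w.monodromyOn p a x l = A at *
    generalize w.monodromyOn p i (p i) l = I at *
    generalize w.act a i x (p i) = R at *
    generalize w.act a j x (p j) = S at *
    generalize w.act i j (p i) (p j) = T at *
    calc R * (S * A) * (T * I) = R * S * (A * T) * I := by simp only [mul_assoc]
      _ = R * S * T * (A * I) := by rw [← h1]; simp only [mul_assoc]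
      _ = T * S * (R * A * I) := by rw [h3]; simp only [mul_assoc]
      _ = T * (S * I) * (A * R) := by rw [h4]; simp only [mul_assoc]
      _ = T * I * (S * A * R) := by rw [h2]; simp only [mul_assoc]

/-- Induction on the list, whose head acts last. The head creates a bare `excited n`, and the
induction hypothesis with auxiliary factor `n` and parameter `p n` trades it for the required vector
plus terms at the other sites; hence `a` and `x` are general. -/
theorem monodromyOn_mulVec_excited {w : Weights Λ} (hU : w.Unitarity) (hYB : w.YangBaxter)
    (p : ι → Λ) {l : List ι} (hl : l.Nodup)
    (hb : ∀ i ∈ l, ∀ j ∈ l, i ≠ j → w.bMinus (p i) (p j) ≠ 0) {a : ι} (ha : a ∉ l) (x : Λ) :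
    w.monodromyOn p a x l *ᵥ excited a =
      (∏ j ∈ l.toFinset, w.bMinus x (p j)) • excited a +
        ∑ i ∈ l.toFinset, (w.cPlus x (p i) *
            ∏ k ∈ l.toFinset.erase i, w.bMinus x (p k) / w.bMinus (p i) (p k)) •
          (w.monodromyOn p i (p i) (suffixAfter i l) *ᵥ excited i) := by
  induction l generalizing a x with
  | nil => simp [Weights.monodromyOn]
  | cons n l ih =>
    rw [List.nodup_cons] at hl
    simp only [List.mem_cons, not_or] at ha
    have hbl : ∀ i ∈ l, ∀ j ∈ l, i ≠ j → w.bMinus (p i) (p j) ≠ 0 := fun i hi j hj =>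
      hb i (List.mem_cons_of_mem _ hi) j (List.mem_cons_of_mem _ hj)
    have hn : n ∉ l.toFinset := by simpa using hl.1
    have hne : ∀ i ∈ l, n ≠ i := fun i hi h => hl.1 (h ▸ hi)
    have hbn : ∀ i ∈ l, w.bMinus (p n) (p i) ≠ 0 := fun i hi =>
      hb n List.mem_cons_self i (List.mem_cons_of_mem _ hi) (hne i hi)
    have hbn' : ∀ i ∈ l, w.bMinus (p i) (p n) ≠ 0 := fun i hi =>
      hb i (List.mem_cons_of_mem _ hi) n List.mem_cons_self (hne i hi).symm
    have hprod : ∏ j ∈ l.toFinset, w.bMinus (p n) (p j) ≠ 0 :=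
      Finset.prod_ne_zero_iff.2 fun i hi => hbn i (by simpa using hi)
    -- Neither `a` nor `n` occurs in this vector's operator, and both are in state `0` in `excited
    -- i`.
    have hfix : ∀ i ∈ l, w.act a n x (p n) *ᵥ
        (w.monodromyOn p i (p i) (suffixAfter i l) *ᵥ excited i) =
          w.monodromyOn p i (p i) (suffixAfter i l) *ᵥ excited i := by
      intro i hi
      obtain ⟨m, hm⟩ := exists_eq_append_suffixAfter hi
      have hsub : ∀ k ∈ suffixAfter i l, k ∈ l := fun k hk => by rw [hm]; simp [hk]
      have hai : a ≠ i := fun h => ha.2 (h ▸ hi)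
      rw [Matrix.mulVec_mulVec, (commute_act_monodromyOn w p _ _ _ (fun h => ha.2 (hsub _ h))
        (fun h => hl.1 (hsub _ h)) hai (hne i hi)).eq, ← Matrix.mulVec_mulVec,
        act_mulVec_excited_of_ne w hai (hne i hi)]
    have hsn : suffixAfter n (n :: l) = l := by simp [suffixAfter]
    have hsi : ∀ i ∈ l, suffixAfter i (n :: l) = suffixAfter i l := fun i hi => by
      simp [suffixAfter, hne i hi]
    rw [monodromyOn_cons, ← Matrix.mulVec_mulVec, ih hl.2 hbl ha.2 x, Matrix.mulVec_add,
      Matrix.mulVec_smul, act_mulVec_excited_fst w ha.1, Matrix.mulVec_sum, List.toFinset_cons,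
      Finset.prod_insert hn, Finset.sum_insert hn, hsn, ih hl.2 hbl hl.1 (p n),
      Finset.erase_insert hn, Finset.prod_div_distrib]
    -- The coefficient at `i` splits by `cPlus_eq_add` with `z = p n`: one part belongs to the
    -- expansion of the vector at `n`, the other is the new coefficient at `i`.
    have e1 : ∀ i ∈ l.toFinset, w.act a n x (p n) *ᵥ ((w.cPlus x (p i) *
            ∏ k ∈ l.toFinset.erase i, w.bMinus x (p k) / w.bMinus (p i) (p k)) •
          (w.monodromyOn p i (p i) (suffixAfter i l) *ᵥ excited i)) =
        (w.cPlus x (p n) * ((∏ j ∈ l.toFinset, w.bMinus x (p j)) /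
            ∏ j ∈ l.toFinset, w.bMinus (p n) (p j))) • ((w.cPlus (p n) (p i) *
            ∏ k ∈ l.toFinset.erase i, w.bMinus (p n) (p k) / w.bMinus (p i) (p k)) •
          (w.monodromyOn p i (p i) (suffixAfter i l) *ᵥ excited i)) +
        (w.cPlus x (p i) * ∏ k ∈ (insert n l.toFinset).erase i,
            w.bMinus x (p k) / w.bMinus (p i) (p k)) •
          (w.monodromyOn p i (p i) (suffixAfter i (n :: l)) *ᵥ excited i) := by
      intro i hi
      have hil : i ∈ l := by simpa using hi
      rw [Matrix.mulVec_smul, hfix i hil, hsi i hil, smul_smul, ← add_smul]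
      congr 1
      rw [Finset.erase_insert_of_ne (hne i hil), Finset.prod_insert (by simp [hn]),
        ← Finset.mul_prod_erase _ _ hi, ← Finset.mul_prod_erase _ _ hi]
      have hq : ∏ j ∈ l.toFinset.erase i, w.bMinus (p n) (p j) ≠ 0 :=
        Finset.prod_ne_zero_iff.2 fun k hk => hbn k (by simpa using Finset.mem_of_mem_erase hk)
      have hr : ∏ j ∈ l.toFinset.erase i, w.bMinus (p i) (p j) ≠ 0 :=
        Finset.prod_ne_zero_iff.2 fun k hk => hbl i hil k
          (by simpa using Finset.mem_of_mem_erase hk) (Finset.ne_of_mem_erase hk).symm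
      have hstar := cPlus_eq_add hU hYB (x := x) (hbn' i hil) (hbn i hil)
      simp only [Finset.prod_div_distrib]
      generalize ∏ j ∈ l.toFinset.erase i, w.bMinus (p n) (p j) = Q at *
      generalize ∏ j ∈ l.toFinset.erase i, w.bMinus (p i) (p j) = R at *
      generalize ∏ j ∈ l.toFinset.erase i, w.bMinus x (p j) = X at *
      have hni := hbn i hil
      have hin := hbn' i hil
      calc w.cPlus x (p i) * (X / R) = (w.cPlus x (p i) *
            (w.bMinus x (p n) / w.bMinus (p i) (p n)) + w.cPlus x (p n) * w.cPlus (p n) (p i) *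
            (w.bMinus x (p i) / w.bMinus (p n) (p i))) * (X / R) := by rw [← hstar]
        _ = _ := by field_simp; ring
    rw [Finset.sum_congr rfl e1, Finset.sum_add_distrib, ← Finset.smul_sum]
    have e2 : w.cPlus x (p n) * ((∏ j ∈ l.toFinset, w.bMinus x (p j)) /
        ∏ j ∈ l.toFinset, w.bMinus (p n) (p j)) * ∏ j ∈ l.toFinset, w.bMinus (p n) (p j) =
        (∏ j ∈ l.toFinset, w.bMinus x (p j)) * w.cPlus x (p n) := by
      field_simp
    simp only [smul_add, smul_smul _ _ (excited n), e2]
    module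

theorem embed_monodromyOn (w : Weights Λ) {e : ι' → ι} (he : Function.Injective e) (p : ι → Λ)
    (a : ι') (x : Λ) (l : List ι') :
    embed e (w.monodromyOn (p ∘ e) a x l) = w.monodromyOn p (e a) x (l.map e) := by
  rw [Weights.monodromyOn, embed_list_prod he, List.map_map, Weights.monodromyOn, List.map_map]
  congr 2
  funext j
  exact embed_act w he _ _ _ _

omit [Fintype ι] [Fintype ι'] in
theorem suffixAfter_map {e : ι' → ι} (he : Function.Injective e) (i : ι') (l : List ι') :
    suffixAfter (e i) (l.map e) = (suffixAfter i l).map e := by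
  induction l with
  | nil => rfl
  | cons n l ih =>
    simp only [List.map_cons, suffixAfter, he.eq_iff, ih]
    split_ifs <;> rfl

theorem act_mulVec_apply_one (w : Weights Λ) (i j : ι) (x y : Λ) (v : (ι → Fin 2) → ℂ) :
    (w.act i j x y *ᵥ v) (fun _ => 1) = w.aMinus x y * v fun _ => 1 := by
  simp [Matrix.mulVec, dotProduct, act_apply_of_eq_one]

theorem monodromyOn_mulVec_apply_one (w : Weights Λ) (p : ι → Λ) (a : ι) (x : Λ) (l : List ι)
    (v : (ι → Fin 2) → ℂ) :
    (w.monodromyOn p a x l *ᵥ v) (fun _ => 1) =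
      (l.map fun j => w.aMinus x (p j)).prod * v fun _ => 1 := by
  induction l with
  | nil => simp [Weights.monodromyOn]
  | cons n l ih =>
    rw [monodromyOn_cons, ← Matrix.mulVec_mulVec, act_mulVec_apply_one, ih, List.map_cons,
      List.prod_cons, mul_assoc]

/-! ### Splitting off the auxiliary factor `none`. -/

theorem sum_option_eq_sum_elim (c : Fin 2) (F : (Option ι → Fin 2) → ℂ)
    (hF : ∀ u, u none ≠ c → F u = 0) :
    ∑ u, F u = ∑ v : ι → Fin 2, F fun o => o.elim c v := by
  refine (Fintype.sum_of_injective (fun (v : ι → Fin 2) (o : Option ι) => o.elim c v)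
    (fun v v' h => funext fun k => congrFun h (some k)) _ _ (fun u hu => hF u fun h => ?_)
    fun v => rfl).symm
  exact hu ⟨fun k => u (some k), funext fun o => by cases o <;> simp [h]⟩

theorem embed_some_apply_elim (A : Matrix (ι → Fin 2) (ι → Fin 2) ℂ) (c : Fin 2)
    (s t : ι → Fin 2) :
    embed some A (fun o => o.elim c s) (fun o => o.elim c t) = A s t := by
  rw [embed, if_pos]
  · rfl
  · rintro (_ | k) hk
    · rfl
    · exact absurd rfl (hk k)

theorem embed_some_apply_of_ne (A : Matrix (ι → Fin 2) (ι → Fin 2) ℂ) {s t : Option ι → Fin 2}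
    (h : s none ≠ t none) : embed some A s t = 0 := by
  rw [embed, if_neg]
  exact fun h' => h (h' none (by simp))

theorem embed_some_mulVec (A : Matrix (ι → Fin 2) (ι → Fin 2) ℂ) (c : Fin 2)
    (φ : (Option ι → Fin 2) → ℂ) (s : ι → Fin 2) :
    (embed some A *ᵥ φ) (fun o => o.elim c s) = (A *ᵥ fun v => φ fun o => o.elim c v) s := by
  rw [Matrix.mulVec, dotProduct, sum_option_eq_sum_elim c fun o => embed some A _ o * φ o]
  · simp only [embed_some_apply_elim]
    rfl
  · intro u hu
    rw [embed_some_apply_of_ne _ (Ne.symm hu), zero_mul]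

/-- The upper right block, in the factor `none`, of an operator. -/
def upperRight (A : Matrix (Option ι → Fin 2) (Option ι → Fin 2) ℂ) :
    Matrix (ι → Fin 2) (ι → Fin 2) ℂ :=
  fun s t => A (fun o => o.elim 0 s) (fun o => o.elim 1 t)

theorem upperRight_embed_some_mul (A : Matrix (ι → Fin 2) (ι → Fin 2) ℂ)
    (X : Matrix (Option ι → Fin 2) (Option ι → Fin 2) ℂ) :
    upperRight (embed some A * X) = A * upperRight X := by
  ext s t
  rw [upperRight, Matrix.mul_apply, sum_option_eq_sum_elim 0 fun u => embed some A _ u * X u _]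
  · simp only [embed_some_apply_elim]
    rfl
  · intro u hu
    rw [embed_some_apply_of_ne _ (Ne.symm hu), zero_mul]

theorem upperRight_mul_embed_some (X : Matrix (Option ι → Fin 2) (Option ι → Fin 2) ℂ)
    (A : Matrix (ι → Fin 2) (ι → Fin 2) ℂ) :
    upperRight (X * embed some A) = upperRight X * A := by
  ext s t
  rw [upperRight, Matrix.mul_apply, sum_option_eq_sum_elim 1 fun u => X _ u * embed some A u _]
  · simp only [embed_some_apply_elim]
    rfl
  · intro u hu
    rw [embed_some_apply_of_ne _ hu, mul_zero]

theorem excited_some_apply_elim (i : ι) (s : ι → Fin 2) :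
    excited (some i) (fun o => o.elim 0 s) = excited i s := by
  rw [excited_apply, excited_apply]
  congr 1
  refine propext ⟨fun h => funext fun k => ?_, fun h => funext fun o => ?_⟩
  · simpa [Pi.single_apply] using congrFun h (some k)
  · subst h
    cases o <;> simp [Pi.single_apply]

theorem excited_none_apply_elim (s : ι → Fin 2) :
    excited none (fun o => o.elim 0 s) = 0 := by
  rw [excited_apply, if_neg]
  intro h
  simpa using congrFun h none

theorem mulVec_excited_none (X : Matrix (Option ι → Fin 2) (Option ι → Fin 2) ℂ)
    (s : ι → Fin 2) :
    (X *ᵥ excited none) (fun o => o.elim 0 s) = upperRight X s fun _ => 0 := by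
  have : (Pi.single none 1 : Option ι → Fin 2) = fun o => o.elim 1 fun _ => 0 := by
    funext o
    cases o <;> simp
  simp [excited, upperRight, this]

/-! ### The ordered chain and the vacuum column of `B`. -/

/-- The sites of a chain of length `M`, in the order of the factors of the monodromy matrix. -/
def sites (M : ℕ) : List (Fin M) := (List.finRange M).reverse

theorem mem_sites {M : ℕ} (i : Fin M) : i ∈ sites M := by simp [sites]

theorem sortedGT_sites (M : ℕ) : (sites M).SortedGT :=
  (List.sortedLT_finRange M).reverse

theorem nodup_sites (M : ℕ) : (sites M).Nodup := (sortedGT_sites M).nodup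

theorem mem_suffixAfter_sites {M : ℕ} {i j : Fin M} : j ∈ suffixAfter i (sites M) ↔ j < i := by
  obtain ⟨m, hm⟩ := exists_eq_append_suffixAfter (mem_sites i)
  have h := (sortedGT_sites M).pairwise
  rw [hm, List.pairwise_append, List.pairwise_cons] at h
  refine ⟨fun hj => h.2.1.1 j hj, fun hj => ?_⟩
  have hmem := mem_sites j
  rw [hm, List.mem_append, List.mem_cons] at hmem
  rcases hmem with hj' | rfl | hj'
  · exact absurd (h.2.2 j hj' i List.mem_cons_self) hj.asymm
  · exact absurd hj (lt_irrefl _)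
  · exact hj'

/-- Both sides of the last equation are strictly decreasing lists with the same members. -/
theorem exists_sites_eq_append {M : ℕ} (i : Fin (M + 1)) :
    ∃ m, sites (M + 1) = m ++ i :: suffixAfter i (sites (M + 1)) ∧
      m ++ suffixAfter i (sites (M + 1)) = (sites M).map i.succAbove := by
  obtain ⟨m, hm⟩ := exists_eq_append_suffixAfter (mem_sites i)
  refine ⟨m, hm, ?_⟩
  have hn := nodup_sites (M + 1)
  rw [hm, List.nodup_middle, List.nodup_cons] at hn
  refine List.SortedGT.eq_of_mem_iff (List.Pairwise.sortedGT ?_) (List.Pairwise.sortedGT ?_) ?_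
  · exact (sortedGT_sites (M + 1)).pairwise.sublist (by
      conv_rhs => rw [hm]
      simp)
  · exact (sortedGT_sites M).pairwise.map _ fun a b h => (Fin.strictMono_succAbove i) h
  · intro j
    have hj := mem_sites j
    rw [hm, List.mem_append, List.mem_cons] at hj
    have : j ∈ (sites M).map i.succAbove ↔ j ≠ i := by
      simp [mem_sites, ← Fin.exists_succAbove_eq_iff]
    rw [this]
    refine ⟨fun h h' => hn.1 (h' ▸ h), fun h => ?_⟩
    rw [List.mem_append]
    tauto

/-- The value `y` at `none` is arbitrary: inhomogeneities are read only at listed factors. -/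
theorem monodromy_eq_monodromyOn (w : Weights Λ) {M : ℕ} (ξ : Fin M → Λ) (x y : Λ) :
    w.monodromy ξ x = w.monodromyOn (fun o => o.elim y ξ) none x ((sites M).map some) := by
  rw [Weights.monodromy, Weights.monodromyOn, List.ofFn_eq_map, ← List.map_reverse, List.map_map]
  rfl

/-- The operator that moves the site `i` in front of the sites below it. -/
def Weights.toFront (w : Weights Λ) {M : ℕ} (ξ : Fin M → Λ) (i : Fin M) :
    Matrix (Fin M → Fin 2) (Fin M → Fin 2) ℂ :=
  w.monodromyOn ξ i (ξ i) (suffixAfter i (sites M))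

theorem toFront_mulVec_apply_one (w : Weights Λ) {M : ℕ} (ξ : Fin M → Λ) (i : Fin M)
    (v : (Fin M → Fin 2) → ℂ) :
    (w.toFront ξ i *ᵥ v) (fun _ => 1) =
      (∏ j ∈ Finset.Iio i, w.aMinus (ξ i) (ξ j)) * v fun _ => 1 := by
  have hn : (suffixAfter i (sites M)).Nodup := by
    obtain ⟨m, hm⟩ := exists_eq_append_suffixAfter (mem_sites i)
    have h := nodup_sites M
    rw [hm, List.nodup_append, List.nodup_cons] at h
    exact h.2.1.2
  rw [Weights.toFront, monodromyOn_mulVec_apply_one, ← List.prod_toFinset _ hn]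
  congr 2
  ext j
  simp [mem_suffixAfter_sites]

theorem B_apply_zero {w : Weights Λ} (hU : w.Unitarity) (hYB : w.YangBaxter) {M : ℕ}
    (ξ : Fin M → Λ) (hb : ∀ i j, i ≠ j → w.bMinus (ξ i) (ξ j) ≠ 0) (x : Λ) (s : Fin M → Fin 2) :
    w.B ξ x s (fun _ => 0) = ∑ i, (w.cPlus x (ξ i) *
      ∏ k ∈ Finset.univ.erase i, w.bMinus x (ξ k) / w.bMinus (ξ i) (ξ k)) *
        (w.toFront ξ i *ᵥ excited i) s := by
  have hinj := Option.some_injective (Fin M)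
  have h := congrFun (monodromyOn_mulVec_excited hU hYB (fun o => o.elim x ξ)
    ((nodup_sites M).map hinj) (by
      intro i hi j hj hij
      obtain ⟨i, -, rfl⟩ := List.mem_map.1 hi
      obtain ⟨j, -, rfl⟩ := List.mem_map.1 hj
      exact hb i j fun h => hij (congrArg _ h)) (a := none) (by simp) x) (fun o => o.elim 0 s)
  rw [← monodromy_eq_monodromyOn, mulVec_excited_none] at h
  refine h.trans ?_
  have ht : ((sites M).map some).toFinset = Finset.univ.image (some : Fin M → Option (Fin M)) := by
    ext o
    simp [mem_sites]
  rw [Pi.add_apply, Pi.smul_apply, excited_none_apply_elim, smul_zero, zero_add,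
    Finset.sum_apply, ht, Finset.sum_image hinj.injOn]
  refine Finset.sum_congr rfl fun i _ => ?_
  rw [Pi.smul_apply, smul_eq_mul, suffixAfter_map hinj, ← Finset.image_erase hinj,
    Finset.prod_image hinj.injOn, ← embed_monodromyOn w hinj, embed_some_mulVec]
  simp only [excited_some_apply_elim]
  rfl

/-! ### Moving a site to the front, and the recursion. -/

/-- The creation operator on a chain whose site `i` has been moved to the front. -/
def Weights.BFront (w : Weights Λ) {M : ℕ} (ξ : Fin (M + 1) → Λ) (i : Fin (M + 1)) (x : Λ) :
    Matrix (Fin (M + 1) → Fin 2) (Fin (M + 1) → Fin 2) ℂ :=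
  upperRight (embed (Option.map i.succAbove) (w.monodromy (fun j => ξ (i.succAbove j)) x) *
    w.act none (some i) x (ξ i))

/-- Split the monodromy at `i`. The RTT relation exchanges `R_{ai}` with the sites below `i`; the
factors above `i` commute with `toFront`, which does not touch `a` or those sites. -/
theorem B_mul_toFront {w : Weights Λ} (hYB : w.YangBaxter) {M : ℕ} (ξ : Fin (M + 1) → Λ)
    (i : Fin (M + 1)) (x : Λ) :
    w.B ξ x * w.toFront ξ i = w.toFront ξ i * w.BFront ξ i x := by
  obtain ⟨m, hm, hm'⟩ := exists_sites_eq_append i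
  have hinj := Option.some_injective (Fin (M + 1))
  have hn := nodup_sites (M + 1)
  rw [hm, List.nodup_middle, List.nodup_cons, List.nodup_append] at hn
  rw [Weights.BFront, ← upperRight_embed_some_mul, show w.B ξ x = upperRight (w.monodromy ξ x)
    from rfl, ← upperRight_mul_embed_some]
  congr 1
  set p : Option (Fin (M + 1)) → Λ := fun o => o.elim x ξ with hp
  have hW : embed some (w.toFront ξ i) = w.monodromyOn p (some i) (p (some i))
      ((suffixAfter i (sites (M + 1))).map some) := embed_monodromyOn w hinj p i (ξ i) _
  have hD : embed (Option.map i.succAbove) (w.monodromy (fun j => ξ (i.succAbove j)) x) =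
      w.monodromyOn p none x (m.map some) *
        w.monodromyOn p none x ((suffixAfter i (sites (M + 1))).map some) := by
    rw [← monodromyOn_append, ← List.map_append, hm', monodromy_eq_monodromyOn w _ x x]
    have he : Function.Injective (Option.map i.succAbove) :=
      Option.map_injective (Fin.succAbove_right_injective)
    have hpe : (fun o : Option (Fin M) => o.elim x fun j => ξ (i.succAbove j)) =
        p ∘ Option.map i.succAbove := by
      funext o
      cases o <;> rfl
    rw [hpe, embed_monodromyOn w he, List.map_map, List.map_map]
    rfl
  have hT : w.monodromy ξ x = w.monodromyOn p none x (m.map some) *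
      (w.act none (some i) x (p (some i)) *
        w.monodromyOn p none x ((suffixAfter i (sites (M + 1))).map some)) := by
    rw [monodromy_eq_monodromyOn w ξ x x, ← monodromyOn_cons, ← List.map_cons,
      ← monodromyOn_append, ← List.map_append, ← hm]
  have hi : i ∉ m ∧ i ∉ suffixAfter i (sites (M + 1)) := by
    simpa [not_or] using hn.1
  have hdisj : m.Disjoint (suffixAfter i (sites (M + 1))) := fun a h h' =>
    hn.2.2.2 a h a h' rfl
  have hex := act_mul_monodromyOn_mul_monodromyOn hYB p (a := none) (i := some i) (by simp) x
    (hn.2.2.1.map hinj) (by simp) (by simpa using hi.2)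
  have hcomm := (commute_monodromyOn w p (a := none) (i := some i) x (p (some i))
    (m := m.map some) (l := (suffixAfter i (sites (M + 1))).map some)
    (List.disjoint_map hinj hdisj) (by simp) (by simpa using hi.1) (by simp)).eq
  rw [hW, hD, hT, mul_assoc, hex, ← mul_assoc, hcomm]
  simp only [mul_assoc]
  rfl

theorem BFront_apply (w : Weights Λ) {M : ℕ} (ξ : Fin (M + 1) → Λ) (i : Fin (M + 1)) (x : Λ)
    (s : Fin (M + 1) → Fin 2) {t : Fin (M + 1) → Fin 2} (ht : t i = 1) :
    w.BFront ξ i x s t = w.aMinus x (ξ i) *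
      embed i.succAbove (w.B (fun j => ξ (i.succAbove j)) x) s t := by
  have h : ∀ u, w.act none (some i) x (ξ i) u (fun o => o.elim 1 t) =
      if u = fun o => o.elim 1 t then w.aMinus x (ξ i) else 0 := fun u =>
    act_apply_of_eq_one w _ _ (Or.inr ⟨rfl, ht⟩)
  simp only [Weights.BFront, upperRight, Matrix.mul_apply, h, mul_ite, mul_zero,
    Finset.sum_ite_eq', Finset.mem_univ, if_true]
  rw [mul_comm]
  congr 1
  rw [embed, embed]
  have hiff : (∀ k : Option (Fin (M + 1)), (∀ j, Option.map i.succAbove j ≠ k) →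
      k.elim (0 : Fin 2) s = k.elim 1 t) ↔ ∀ k, (∀ j, i.succAbove j ≠ k) → s k = t k := by
    refine ⟨fun h k hk => h (some k) ?_, fun h k hk => ?_⟩
    · rintro (_ | j)
      · simp
      · simpa using hk j
    · cases k with
      | none => exact absurd rfl (hk none)
      | some k => exact h k fun j hj => hk (some j) (by simp [hj])
  simp only [hiff]
  congr 1
  rw [Weights.B]
  congr 1 <;> funext o <;> cases o <;> rfl

theorem list_prod_BFront_apply (w : Weights Λ) {M : ℕ} (ξ : Fin (M + 1) → Λ) (i : Fin (M + 1))
    (xs : List Λ) (s : Fin (M + 1) → Fin 2) {t : Fin (M + 1) → Fin 2} (ht : t i = 1) :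
    (xs.map (w.BFront ξ i)).prod s t = (xs.map fun x => w.aMinus x (ξ i)).prod *
      embed i.succAbove (xs.map (w.B fun j => ξ (i.succAbove j))).prod s t := by
  induction xs generalizing s with
  | nil => simp [embed_one]
  | cons x xs ih =>
    simp only [List.map_cons, List.prod_cons, embed_mul Fin.succAbove_right_injective,
      Matrix.mul_apply, Finset.mul_sum, ih]
    refine Finset.sum_congr rfl fun u _ => ?_
    by_cases hu : u i = 1
    · rw [BFront_apply w ξ i x s hu]
      ring
    -- The remaining operators act trivially on site `i`, so it stays in state `1`.
    · have : embed i.succAbove (xs.map (w.B fun j => ξ (i.succAbove j))).prod u t = 0 := by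
        rw [embed, if_neg]
        exact fun h => hu ((h i fun j => Fin.succAbove_ne i j).trans ht)
      rw [this]
      ring

theorem list_prod_B_mul_toFront {w : Weights Λ} (hYB : w.YangBaxter) {M : ℕ}
    (ξ : Fin (M + 1) → Λ) (i : Fin (M + 1)) (xs : List Λ) :
    (xs.map (w.B ξ)).prod * w.toFront ξ i = w.toFront ξ i * (xs.map (w.BFront ξ i)).prod := by
  induction xs with
  | nil => simp
  | cons x xs ih =>
    rw [List.map_cons, List.prod_cons, mul_assoc, ih, ← mul_assoc, B_mul_toFront hYB,
      List.map_cons, List.prod_cons, mul_assoc]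

theorem ZB_eq_list_prod (w : Weights Λ) {M : ℕ} (μ ξ : Fin M → Λ) :
    w.ZB μ ξ = ((List.ofFn μ).map (w.B ξ)).prod (fun _ => 1) (fun _ => 0) := by
  rw [Weights.ZB, List.map_ofFn]
  rfl

/-- Expansion of the domain wall partition function along its last rapidity. -/
theorem ZB_succ {w : Weights Λ} (hU : w.Unitarity) (hYB : w.YangBaxter) {M : ℕ}
    (μ ξ : Fin (M + 1) → Λ) (hb : ∀ i j, i ≠ j → w.bMinus (ξ i) (ξ j) ≠ 0) :
    w.ZB μ ξ = ∑ i, (w.cPlus (μ (Fin.last M)) (ξ i) * ∏ k ∈ Finset.univ.erase i,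
        w.bMinus (μ (Fin.last M)) (ξ k) / w.bMinus (ξ i) (ξ k)) *
      ((∏ j ∈ Finset.Iio i, w.aMinus (ξ i) (ξ j)) *
        ((∏ k : Fin M, w.aMinus (μ k.castSucc) (ξ i)) *
          w.ZB (fun k => μ k.castSucc) (fun j => ξ (i.succAbove j)))) := by
  have hZ : w.ZB μ ξ = (((List.ofFn fun k : Fin M => μ k.castSucc).map (w.B ξ)).prod *ᵥ
      fun s => w.B ξ (μ (Fin.last M)) s fun _ => 0) (fun _ => 1) := by
    rw [ZB_eq_list_prod, List.ofFn_succ', List.concat_eq_append, List.map_append,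
      List.prod_append]
    simp [Matrix.mul_apply, Matrix.mulVec, dotProduct]
  have hcol : (fun s => w.B ξ (μ (Fin.last M)) s fun _ => 0) =
      ∑ i, (w.cPlus (μ (Fin.last M)) (ξ i) * ∏ k ∈ Finset.univ.erase i,
        w.bMinus (μ (Fin.last M)) (ξ k) / w.bMinus (ξ i) (ξ k)) •
          (w.toFront ξ i *ᵥ excited i) := by
    funext s
    rw [B_apply_zero hU hYB ξ hb, Finset.sum_apply]
    rfl
  rw [hZ, hcol, Matrix.mulVec_sum, Finset.sum_apply]
  refine Finset.sum_congr rfl fun i _ => ?_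
  -- After the exchange `toFront` stands leftmost, where `⟨1|` replaces it by its eigenvalue.
  rw [Matrix.mulVec_smul, Pi.smul_apply, smul_eq_mul, Matrix.mulVec_mulVec,
    list_prod_B_mul_toFront hYB, ← Matrix.mulVec_mulVec, toFront_mulVec_apply_one]
  congr 2
  have hone : ∀ X : Matrix (Fin (M + 1) → Fin 2) (Fin (M + 1) → Fin 2) ℂ,
      (X *ᵥ excited i) (fun _ => 1) = X (fun _ => 1) (Pi.single i 1) := fun X => by
    simp [excited]
  rw [hone, list_prod_BFront_apply w ξ i _ _ (Pi.single_eq_same i 1), List.map_ofFn,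
    List.prod_ofFn, ZB_eq_list_prod]
  congr 1
  rw [embed, if_pos]
  · have h : (Pi.single i 1 : Fin (M + 1) → Fin 2) ∘ i.succAbove = fun _ => 0 := by
      funext j
      simp
    rw [h]
    rfl
  · intro k hk
    have : k = i := by
      by_contra h
      obtain ⟨j, hj⟩ := Fin.exists_succAbove_eq h
      exact hk j hj
    simp [this]

end

/-! ### From the recursion to the sum over permutations. -/

/-- The permutation of `Fin (M + 1)` that sends the last element to `i` and acts on the others
as `τ`. -/
def permOfLast {M : ℕ} (i : Fin (M + 1)) (τ : Equiv.Perm (Fin M)) : Equiv.Perm (Fin (M + 1)) :=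
  (finSuccEquiv' (Fin.last M)).trans ((Equiv.optionCongr τ).trans (finSuccEquiv' i).symm)

theorem permOfLast_last {M : ℕ} (i : Fin (M + 1)) (τ : Equiv.Perm (Fin M)) :
    permOfLast i τ (Fin.last M) = i := by
  simp [permOfLast]

theorem permOfLast_castSucc {M : ℕ} (i : Fin (M + 1)) (τ : Equiv.Perm (Fin M)) (j : Fin M) :
    permOfLast i τ j.castSucc = i.succAbove (τ j) := by
  rw [← Fin.succAbove_last_apply, permOfLast, Equiv.trans_apply, finSuccEquiv'_succAbove]
  simp

theorem bijective_permOfLast (M : ℕ) : Function.Bijective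
    fun q : Fin (M + 1) × Equiv.Perm (Fin M) => permOfLast q.1 q.2 := by
  rw [Fintype.bijective_iff_injective_and_card]
  refine ⟨?_, by simp [Fintype.card_perm, Nat.factorial_succ]⟩
  rintro ⟨i, τ⟩ ⟨i', τ'⟩ h
  have hi : i = i' := by
    rw [← permOfLast_last i τ, ← permOfLast_last i' τ']
    exact congrArg (· (Fin.last M)) h
  subst hi
  have hτ : τ = τ' := by
    ext1 j
    apply Fin.succAbove_right_injective (p := i)
    rw [← permOfLast_castSucc, ← permOfLast_castSucc]
    exact congrArg (· j.castSucc) h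
  rw [hτ]

theorem prod_Ioi_last {α : Type*} [CommMonoid α] {M : ℕ} (F : Fin (M + 1) → Fin (M + 1) → α) :
    ∏ j, ∏ k ∈ Finset.Ioi j, F j k =
      (∏ j : Fin M, ∏ k ∈ Finset.Ioi j, F j.castSucc k.castSucc) *
        ∏ j : Fin M, F j.castSucc (Fin.last M) := by
  rw [Fin.prod_univ_castSucc, ← Finset.prod_mul_distrib]
  have h0 : Finset.Ioi (Fin.last M) = ∅ := by
    ext k
    simp [Fin.le_last]
  rw [h0, Finset.prod_empty, mul_one]
  refine Finset.prod_congr rfl fun j _ => ?_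
  have h : Finset.Ioi j.castSucc =
      insert (Fin.last M) ((Finset.Ioi j).map Fin.castSuccEmb) := by
    ext k
    refine Fin.lastCases ?_ (fun k => ?_) k
    · simp [Fin.castSucc_lt_last]
    · simpa using fun _ => Fin.le_last _
  rw [h, Finset.prod_insert (by simp), Finset.prod_map, mul_comm]
  rfl

theorem prod_erase_eq_prod_succAbove {α : Type*} [CommMonoid α] {M : ℕ} (i : Fin (M + 1))
    (f : Fin (M + 1) → α) (τ : Equiv.Perm (Fin M)) :
    ∏ k ∈ Finset.univ.erase i, f k = ∏ j : Fin M, f (i.succAbove (τ j)) := by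
  rw [Equiv.prod_comp τ fun j => f (i.succAbove j)]
  have h : Finset.univ.erase i = Finset.univ.map i.succAboveEmb := by
    ext k
    simp [Fin.exists_succAbove_eq_iff]
  rw [h, Finset.prod_map]
  rfl

section

variable {Λ : Type*}

/-- Used twice: for `succAbove` when a site is removed, and for the choice of sites `l` in the full
chain. -/
theorem theta_comp (w : Weights Λ) {L M : ℕ} (ξ : Fin L → Λ) {l : Fin M → Fin L}
    (hl : StrictMono l) (i j : Fin M) :
    w.theta (fun k => ξ (l k)) i j = w.theta ξ (l i) (l j) := by
  simp only [Weights.theta, hl.lt_iff_lt]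

theorem prod_Iio_aMinus {w : Weights Λ} (hU : w.Unitarity) {M : ℕ} (ξ : Fin M → Λ) (i : Fin M) :
    ∏ j ∈ Finset.Iio i, w.aMinus (ξ i) (ξ j) =
      ∏ j ∈ Finset.univ.erase i, (w.theta ξ j i)⁻¹ := by
  have h : Finset.Iio i = (Finset.univ.erase i).filter (· < i) := by
    ext j
    simpa using fun h : j < i => h.ne
  rw [h, Finset.prod_filter]
  refine Finset.prod_congr rfl fun j _ => ?_
  rw [Weights.theta]
  split_ifs
  · exact eq_inv_of_mul_eq_one_left (hU.aMinus_mul_aMinus _ _)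
  · exact inv_one.symm

theorem ZB_eq_sum_perm {w : Weights Λ} (hU : w.Unitarity) (hYB : w.YangBaxter) {M : ℕ}
    (μ ξ : Fin M → Λ) (hb : ∀ i j, i ≠ j → w.bMinus (ξ i) (ξ j) ≠ 0) :
    w.ZB μ ξ = ∑ σ : Equiv.Perm (Fin M), (∏ i, w.cPlus (μ i) (ξ (σ i))) *
      ∏ j, ∏ k ∈ Finset.Ioi j, (w.bMinus (μ k) (ξ (σ j)) * w.aMinus (μ j) (ξ (σ k))) /
        (w.bMinus (ξ (σ k)) (ξ (σ j)) * w.theta ξ (σ j) (σ k)) := by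
  induction M with
  | zero => simp [Weights.ZB, Matrix.one_apply, funext_iff]
  | succ M ih =>
    rw [ZB_succ hU hYB μ ξ hb, ← (bijective_permOfLast M).sum_comp, Fintype.sum_prod_type]
    refine Finset.sum_congr rfl fun i _ => ?_
    rw [ih _ _ fun j k hjk => hb _ _ (Fin.succAbove_right_injective.ne hjk), Finset.mul_sum,
      Finset.mul_sum, Finset.mul_sum]
    refine Finset.sum_congr rfl fun τ _ => ?_
    -- The prefactors of the recursion become exactly the factors of the formula with `k` last,
    -- where `σ` sends the last index to `i`.
    rw [prod_Iio_aMinus hU, prod_erase_eq_prod_succAbove i _ τ, prod_erase_eq_prod_succAbove i _ τ,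
      Fin.prod_univ_castSucc, prod_Ioi_last]
    simp only [permOfLast_last, permOfLast_castSucc, theta_comp w ξ (Fin.strictMono_succAbove i),
      Finset.prod_div_distrib, Finset.prod_mul_distrib, Finset.prod_inv_distrib]
    simp only [div_eq_mul_inv, mul_inv]
    ring

end

end SixVertex

theorem mainTheorem4 {Λ : Type*} (w : SixVertex.Weights Λ)
    (hU : w.Unitarity) (hYB : w.YangBaxter)
    {L M : ℕ} (ξ : Fin L → Λ) (l : Fin M → Fin L) (hl : StrictMono l) (μ : Fin M → Λ)
    (hb : ∀ i j : Fin M, i ≠ j → w.bMinus (ξ (l i)) (ξ (l j)) ≠ 0) :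
    w.ZB μ (fun i => ξ (l i)) =
      ∑ σ : Equiv.Perm (Fin M),
        (∏ i : Fin M, w.cPlus (μ i) (ξ (l (σ i)))) *
          ∏ j : Fin M, ∏ k ∈ Finset.Ioi j,
            (w.bMinus (μ k) (ξ (l (σ j))) * w.aMinus (μ j) (ξ (l (σ k)))) /
              (w.bMinus (ξ (l (σ k))) (ξ (l (σ j))) * w.theta ξ (l (σ j)) (l (σ k))) := by
  rw [SixVertex.ZB_eq_sum_perm hU hYB μ (fun i => ξ (l i)) hb]
  simp only [SixVertex.theta_comp w ξ hl]
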